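/- Let $N\ge 1$ be an integer. Let $U$ be a Haar-distributed random matrix in the unitary group $U(N)$, and let $x$ be a random pure state, independent of $U$, distributed according to the Fubini--Study probability measure $\mu_{\mathrm{FS}}$ on $\Omega_N=\mathbb{C}P^{N-1}$, i.e. the unitarily invariant probability measure induced by the Haar measure on $U(N)$ (the law of the line $[Ve_1]$ for a Haar random $V$). For a complex $N\times N$ matrix $A$ and a unit vector $x$ representing a pure state, $\langle x|A|x\rangle$ depends only on the state, and the numerical shadow $P_A$ is the law of $\langle x|A|x\rangle$ on $\mathbb{C}$ when $x$ is distributed according to $\mu_{\mathrm{FS}}$. The numerical shadow of the random matrix $U$ is the mixture $P_U(B)=\int_{U(N)}P_V(B)\,dV$ ($B\subseteq\mathbb{C}$ Borel, $dV$ normalized Haar measure); equivalently, it is the law of $\langle x|U|x\rangle$ for independent $U$ and $x$ as above. Then: (1) the numerical shadow of $U$ is a Borel probability measure supported in the closed unit disk $\{z\in\mathbb{C}:|z|\le 1\}$; (2) it is invariant under rotations $z\mapsto cz$ for all $c\in\mathbb{C}$ with $|c|=1$; (3) if $N\ge 2$, then $|\langle x|U|x\rangle|^2$ has the Beta distribution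 with parameters $\{1,N-1\}$, that is, the density $(N-1)(1-r)^{N-2}$ on $0<r<1$. -/

import Mathlib

open MeasureTheory

noncomputable section

namespace RandomShadow

/-- Complex matrices of order `N` carry the Borel σ-algebra of their entrywise topology. -/
instance instMeasurableSpaceMatrix (N : ℕ) : MeasurableSpace (Matrix (Fin N) (Fin N) ℂ) :=
  borel _

instance instBorelSpaceMatrix (N : ℕ) : BorelSpace (Matrix (Fin N) (Fin N) ℂ) := ⟨rfl⟩

instance instCompactSpaceUnitaryGroup (N : ℕ) :
    CompactSpace (Matrix.unitaryGroup (Fin N) ℂ) := by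
  have hc : IsCompact {A : Matrix (Fin N) (Fin N) ℂ | ∀ i j, A i j ∈ Metric.closedBall (0 : ℂ) 1} :=
    isCompact_pi_infinite (X := fun _ : Fin N => Fin N → ℂ)
      (s := fun _ => {r | ∀ j, r j ∈ Metric.closedBall (0 : ℂ) 1})
      fun _ => isCompact_pi_infinite fun _ => isCompact_closedBall 0 1
  have hcl : IsClosed {A : Matrix (Fin N) (Fin N) ℂ | A * star A = 1} :=
    isClosed_eq (by fun_prop) continuous_const
  have h := hc.inter_right hcl
  have he : ({A : Matrix (Fin N) (Fin N) ℂ | ∀ i j, A i j ∈ Metric.closedBall (0 : ℂ) 1} ∩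
      {A | A * star A = 1}) = (Matrix.unitaryGroup (Fin N) ℂ : Set (Matrix (Fin N) (Fin N) ℂ)) := by
    ext A
    refine ⟨fun hA => Matrix.mem_unitaryGroup_iff.mpr hA.2, fun hA =>
      ⟨fun i j => ?_, Matrix.mem_unitaryGroup_iff.mp hA⟩⟩
    simpa using entry_norm_bound_of_unitary hA i j
  rw [he] at h
  exact isCompact_iff_compactSpace.mp h

/-- The normalized Haar measure on the unitary group `U(N)`. -/
def haarUnitary (N : ℕ) : Measure (Matrix.unitaryGroup (Fin N) ℂ) :=
  Measure.haarMeasure (⊤ : TopologicalSpace.PositiveCompacts (Matrix.unitaryGroup (Fin N) ℂ))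

/-- The law, on matrices of order `N`, of a Haar random unitary matrix. -/
def haarLaw (N : ℕ) : Measure (Matrix (Fin N) (Fin N) ℂ) :=
  (haarUnitary N).map (fun U : Matrix.unitaryGroup (Fin N) ℂ => (U : Matrix (Fin N) (Fin N) ℂ))

/-- The set `Ω_N = ℂP^{N-1}` of pure states of size `N`. -/
abbrev PureState (N : ℕ) : Type := Projectivization ℂ (EuclideanSpace ℂ (Fin N))

/-- The quotient topology on `ℂP^{N-1}`. -/
instance instTopologicalSpacePureState (N : ℕ) : TopologicalSpace (PureState N) :=
  TopologicalSpace.coinduced (Projectivization.mk' ℂ) inferInstance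

instance instMeasurableSpacePureState (N : ℕ) : MeasurableSpace (PureState N) := borel _

instance instBorelSpacePureState (N : ℕ) : BorelSpace (PureState N) := ⟨rfl⟩

/-- The first column `U e₀` of a matrix, as a vector of the Hilbert space `ℂ^N`. -/
def firstColumn {N : ℕ} [NeZero N] (A : Matrix (Fin N) (Fin N) ℂ) : EuclideanSpace ℂ (Fin N) :=
  WithLp.toLp 2 (fun i => A i 0)

theorem firstColumn_ne_zero {N : ℕ} [NeZero N] (U : Matrix.unitaryGroup (Fin N) ℂ) :
    firstColumn (U : Matrix (Fin N) (Fin N) ℂ) ≠ 0 := by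
  intro h
  have h1 := congrFun (congrFun (Matrix.mem_unitaryGroup_iff'.mp U.2) 0) 0
  have h2 : ∀ i, (U : Matrix (Fin N) (Fin N) ℂ) i 0 = 0 := fun i =>
    congrArg (fun v : EuclideanSpace ℂ (Fin N) => v i) h
  simp [Matrix.mul_apply, h2] at h1

/-- The Fubini–Study probability measure on pure states: the unitarily invariant measure induced
by the Haar measure on `U(N)`, that is, the law of the state `U|0⟩` for a Haar random `U`. -/
def fubiniStudy (N : ℕ) [NeZero N] : Measure (PureState N) :=
  (haarUnitary N).map
    (fun U : Matrix.unitaryGroup (Fin N) ℂ =>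
      Projectivization.mk ℂ (firstColumn (U : Matrix (Fin N) (Fin N) ℂ))
      (firstColumn_ne_zero U))

/-- The expectation value `⟨x|A|x⟩` of `A` in the pure state `x`; on the class of a nonzero
vector `v` it is `⟨v, A v⟩ / ⟨v, v⟩`, so `⟨v, A v⟩` when `v` is normalized. -/
def expectation {N : ℕ} (A : Matrix (Fin N) (Fin N) ℂ) (x : PureState N) : ℂ :=
  Projectivization.lift
    (fun v : {v : EuclideanSpace ℂ (Fin N) // v ≠ 0} =>
      inner ℂ v.1 (Matrix.toEuclideanLin A v.1) / inner ℂ v.1 v.1)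
    (by
      rintro ⟨a, ha⟩ ⟨b, hb⟩ t h
      have hab : a = t • b := h
      have ht : t ≠ 0 := by
        rintro rfl
        exact ha (by simpa using hab)
      subst hab
      have h2 : (starRingEnd ℂ) t ≠ 0 := by simpa using ht
      simp only [map_smul, inner_smul_left, inner_smul_right]
      rw [← mul_assoc, ← mul_assoc, mul_div_mul_left _ _ (mul_ne_zero ht h2)])
    x

/-- The numerical shadow `P_A` of a matrix `A`: the law on `ℂ` of `⟨x|A|x⟩` for a pure state `x`
distributed according to the Fubini–Study measure. -/
def numericalShadow {N : ℕ} [NeZero N] (A : Matrix (Fin N) (Fin N) ℂ) : Measure ℂ :=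
  (fubiniStudy N).map (expectation A)

/-- The numerical shadow of a random matrix with law `μ`: the mixture of the shadows `P_A`
over `A` distributed according to `μ`. -/
def randomNumericalShadow {N : ℕ} [NeZero N] (μ : Measure (Matrix (Fin N) (Fin N) ℂ)) :
    Measure ℂ :=
  μ.bind numericalShadow

end RandomShadow

end

/-!
Haar measure on the compact group `U(N)` is invariant on both sides. For a state `x = W|0⟩` one has
`⟨x|V|x⟩ = (W* V W)₀₀`, and for each fixed `W` the matrix `W* V W` is again Haar distributed. Hence
the shadow of a Haar random unitary matrix is the law of the corner entry `V₀₀`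
(`randomNumericalShadow_haarLaw`). The entries of a unitary matrix have modulus at most one, and
multiplying `V` by a scalar matrix of modulus one preserves Haar measure; this gives the support and
the rotation invariance.

For the law of `|V₀₀|²`, right invariance and transitivity of `U(N)` on the unit sphere show that
`|(V w)₀|² / |w|²` has the law of `|V₀₀|²` for each fixed `w ≠ 0` (`haarUnitary_ratio_gt_const`).
This remains true for a standard complex Gaussian vector `w` independent of `V`; but the Gaussian
measure is unitarily invariant (`map_pi_complexGaussian_mulVec_unitary`), so that the law in
question is that of `|w₀|² / |w|²`. The `|wᵢ|²` are independent exponential variables, and with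
`t = r / (1 - r)`
`P(|w₀|² > r |w|²) = P(|w₀|² > t ∑_{i ≠ 0} |wᵢ|²) = E exp(-t ∑_{i ≠ 0} |wᵢ|²) = (1 + t)^{-(N-1)}`,
which is `(1 - r)^{N-1}` (`pi_complexGaussian_ratio_gt`), the tail of `Beta(1, N - 1)`
(`betaMeasure_one_Ioi`).
-/

namespace RandomShadow
open scoped ENNReal Matrix

/-! ### The standard complex Gaussian measure -/

/-- The standard complex Gaussian measure on `ℂ`, with density `π⁻¹ exp (-|z|²)`. -/
noncomputable def complexGaussian : Measure ℂ :=
  (volume : Measure ℂ).withDensity fun z => ENNReal.ofReal (Real.pi⁻¹ * Real.exp (-‖z‖ ^ 2))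

theorem integral_exp_neg_mul_normSq {b : ℝ} (hb : 0 < b) :
    ∫ z : ℂ, Real.exp (-b * ‖z‖ ^ 2) = Real.pi / b := by
  have h := GaussianFourier.integral_rexp_neg_mul_sq_norm (V := ℂ) hb
  simpa [Complex.finrank_real_complex] using h

theorem integrable_exp_neg_mul_normSq {b : ℝ} (hb : 0 < b) :
    Integrable fun z : ℂ => Real.exp (-b * ‖z‖ ^ 2) := by
  -- the Bochner integral of a non-integrable function is zero
  refine Integrable.of_integral_ne_zero ?_
  rw [integral_exp_neg_mul_normSq hb]
  positivity

theorem integrable_gaussianDensity :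
    Integrable fun z : ℂ => Real.pi⁻¹ * Real.exp (-‖z‖ ^ 2) := by
  simpa using (integrable_exp_neg_mul_normSq one_pos).const_mul Real.pi⁻¹

theorem integral_complexGaussian (f : ℂ → ℝ) :
    ∫ z, f z ∂complexGaussian = ∫ z : ℂ, Real.pi⁻¹ * Real.exp (-‖z‖ ^ 2) * f z := by
  rw [complexGaussian, integral_withDensity_eq_integral_toReal_smul (by fun_prop)
    (by simp)]
  refine integral_congr_ae (Filter.Eventually.of_forall fun z => ?_)
  simp only [smul_eq_mul]
  rw [ENNReal.toReal_ofReal (by positivity)]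

/-- The Laplace transform of `|z|²`, which is exponentially distributed. -/
theorem integral_exp_neg_mul_normSq_complexGaussian {t : ℝ} (ht : 0 ≤ t) :
    ∫ z, Real.exp (-t * ‖z‖ ^ 2) ∂complexGaussian = (1 + t)⁻¹ := by
  rw [integral_complexGaussian]
  have : ∀ z : ℂ, Real.pi⁻¹ * Real.exp (-‖z‖ ^ 2) * Real.exp (-t * ‖z‖ ^ 2)
      = Real.pi⁻¹ * Real.exp (-(1 + t) * ‖z‖ ^ 2) := fun z => by
    rw [mul_assoc, ← Real.exp_add]; ring_nf
  simp_rw [this]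
  rw [integral_const_mul, integral_exp_neg_mul_normSq (by positivity)]
  field_simp

instance : IsProbabilityMeasure complexGaussian := by
  constructor
  rw [complexGaussian, withDensity_apply _ MeasurableSet.univ, Measure.restrict_univ,
    ← ofReal_integral_eq_lintegral_ofReal integrable_gaussianDensity
      (Filter.Eventually.of_forall fun z => by positivity)]
  have := integral_exp_neg_mul_normSq one_pos
  simp only [neg_mul, one_mul, div_one] at this
  rw [integral_const_mul, this, inv_mul_cancel₀ Real.pi_ne_zero, ENNReal.ofReal_one]

instance : NullSingletonClass complexGaussian := by
  unfold complexGaussian; infer_instance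

/-- The tail of `|z|²`, which is exponentially distributed. -/
theorem complexGaussian_normSq_gt {s : ℝ} (hs : 0 ≤ s) :
    complexGaussian {z | s < ‖z‖ ^ 2} = ENNReal.ofReal (Real.exp (-s)) := by
  have hm : MeasurableSet {z : ℂ | s < ‖z‖ ^ 2} := measurableSet_lt (by fun_prop) (by fun_prop)
  rw [← ofReal_measureReal]
  congr 1
  rw [← integral_indicator_one hm, integral_complexGaussian]
  have h1 : ∀ z : ℂ, Real.pi⁻¹ * Real.exp (-‖z‖ ^ 2) *
      Set.indicator {z : ℂ | s < ‖z‖ ^ 2} 1 z =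
      (fun r : ℝ => Real.pi⁻¹ * (Set.Ioi √s).indicator (fun r => Real.exp (-r ^ 2)) r) ‖z‖ := by
    intro z
    by_cases h : s < ‖z‖ ^ 2
    · have h' : √s < ‖z‖ := (Real.sqrt_lt' (by by_contra! h0; nlinarith [norm_nonneg z])).2 h
      simp [Set.indicator, h, h']
    · have h' : ¬ √s < ‖z‖ := fun h0 => h ((Real.sqrt_lt_sqrt_iff hs).1
        (by rwa [Real.sqrt_sq (norm_nonneg z)]))
      simp [Set.indicator, h, h']
  simp_rw [h1]
  -- polar coordinates reduce to the integral of `r exp (-r²)` over `r > √s`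
  rw [integral_fun_norm_addHaar volume
    (fun r : ℝ => Real.pi⁻¹ * (Set.Ioi √s).indicator (fun r => Real.exp (-r ^ 2)) r)]
  have h2 : ∀ y : ℝ, y ^ (2 - 1) • (Real.pi⁻¹ * (Set.Ioi √s).indicator
      (fun r => Real.exp (-r ^ 2)) y) =
      (Set.Ioi √s).indicator (fun r => Real.pi⁻¹ * (r * Real.exp (-r ^ 2))) y := by
    intro y
    by_cases h : √s < y <;> simp [Set.indicator, h]; ring
  simp only [Complex.finrank_real_complex, h2]
  have h3 : Set.Ioi √s ∩ Set.Ioi 0 = Set.Ioi √s :=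
    Set.inter_eq_left.2 (Set.Ioi_subset_Ioi (Real.sqrt_nonneg s))
  rw [integral_indicator measurableSet_Ioi, Measure.restrict_restrict measurableSet_Ioi, h3,
    integral_const_mul]
  have h4 : ∫ r in Set.Ioi √s, r * Real.exp (-r ^ 2) = Real.exp (-s) / 2 := by
    have hd : ∀ x ∈ Set.Ici √s, HasDerivAt (fun r => -(Real.exp (-r ^ 2) / 2))
        (x * Real.exp (-x ^ 2)) x := by
      intro x _
      have := (((hasDerivAt_pow 2 x).fun_neg).exp.div_const 2).fun_neg
      refine this.congr_deriv ?_
      simp; ring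
    have hl : Filter.Tendsto (fun r : ℝ => -(Real.exp (-r ^ 2) / 2)) Filter.atTop (nhds 0) := by
      have : Filter.Tendsto (fun r : ℝ => Real.exp (-r ^ 2)) Filter.atTop (nhds 0) :=
        Real.tendsto_exp_neg_atTop_nhds_zero.comp (Filter.tendsto_pow_atTop two_ne_zero)
      simpa using (this.div_const 2).neg
    rw [integral_Ioi_of_hasDerivAt_of_nonneg' hd (fun x hx => ?_) hl]
    · rw [Real.sq_sqrt hs]; ring
    · have : 0 ≤ x := (Real.sqrt_nonneg s).trans (le_of_lt hx)
      positivity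
  rw [h4]
  have h5 : (volume : Measure ℂ).real (Metric.ball 0 1) = Real.pi := by
    simp [Measure.real, Complex.volume_ball]
  rw [h5]
  simp only [smul_eq_mul, nsmul_eq_mul]
  field_simp
  norm_num

/-- A finite product of complex Gaussian measures has the product density. -/
theorem pi_complexGaussian_eq_withDensity (ι : Type*) [Fintype ι] :
    Measure.pi (fun _ : ι => complexGaussian) =
      (volume : Measure (ι → ℂ)).withDensity
        fun v => ENNReal.ofReal (∏ i, Real.pi⁻¹ * Real.exp (-‖v i‖ ^ 2)) := by
  refine (Measure.pi_eq fun s hs => ?_)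
  have hint : ∀ i, Integrable (fun z : ℂ => Real.pi⁻¹ * Real.exp (-‖z‖ ^ 2))
      (volume.restrict (s i)) := fun i => integrable_gaussianDensity.restrict
  rw [withDensity_apply _ (MeasurableSet.univ_pi hs), volume_pi, Measure.restrict_pi_pi,
    ← ofReal_integral_eq_lintegral_ofReal (Integrable.fintype_prod_dep hint)
      (Filter.Eventually.of_forall fun z => by positivity),
    integral_fintype_prod_eq_prod (fun _ z => Real.pi⁻¹ * Real.exp (-‖z‖ ^ 2)),
    ENNReal.ofReal_prod_of_nonneg fun i _ => by positivity]
  refine Finset.prod_congr rfl fun i _ => ?_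
  rw [complexGaussian, withDensity_apply _ (hs i), ofReal_integral_eq_lintegral_ofReal (hint i)
    (Filter.Eventually.of_forall fun z => by positivity)]

theorem sum_normSq_mulVec_unitary {ι : Type*} [Fintype ι] [DecidableEq ι]
    (U : Matrix.unitaryGroup ι ℂ) (v : ι → ℂ) :
    ∑ i, ‖((U : Matrix ι ι ℂ) *ᵥ v) i‖ ^ 2 = ∑ i, ‖v i‖ ^ 2 := by
  have key : ∀ w : ι → ℂ, star w ⬝ᵥ w = ((∑ i, ‖w i‖ ^ 2 : ℝ) : ℂ) := by
    intro w
    simp [dotProduct, Complex.conj_mul']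
  have h : star ((U : Matrix ι ι ℂ) *ᵥ v) ⬝ᵥ ((U : Matrix ι ι ℂ) *ᵥ v) = star v ⬝ᵥ v := by
    rw [Matrix.star_mulVec, Matrix.dotProduct_mulVec, Matrix.vecMul_vecMul,
      ← Matrix.star_eq_conjTranspose, Matrix.mem_unitaryGroup_iff'.mp U.2, Matrix.vecMul_one]
  rw [key, key] at h
  exact_mod_cast h

theorem map_volume_mulVec_unitary {ι : Type*} [Fintype ι] [DecidableEq ι]
    (U : Matrix.unitaryGroup ι ℂ) :
    (volume : Measure (ι → ℂ)).map (fun v => (U : Matrix ι ι ℂ) *ᵥ v) = volume := by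
  let f : (ι → ℂ) →ₗ[ℝ] (ι → ℂ) := (Matrix.toLin' (U : Matrix ι ι ℂ)).restrictScalars ℝ
  -- the real determinant of a complex linear map is the squared modulus of the complex one
  have hU : ‖(U : Matrix ι ι ℂ).det‖ = 1 := by
    have h := congrArg Matrix.det (Matrix.mem_unitaryGroup_iff.mp U.2)
    rw [Matrix.det_mul, Matrix.star_eq_conjTranspose, Matrix.det_conjTranspose, Matrix.det_one,
      Complex.star_def, Complex.mul_conj'] at h
    have h' : ‖(U : Matrix ι ι ℂ).det‖ ^ 2 = 1 := by exact_mod_cast h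
    exact (pow_eq_one_iff_of_nonneg (norm_nonneg _) two_ne_zero).1 h'
  have hdet : LinearMap.det f = 1 := by
    rw [LinearMap.det_restrictScalars, LinearMap.det_toLin', Algebra.norm_complex_apply,
      Complex.normSq_eq_norm_sq, hU, one_pow]
  have h := Measure.map_linearMap_addHaar_eq_smul_addHaar (volume : Measure (ι → ℂ))
    (f := f) (by rw [hdet]; exact one_ne_zero)
  rw [hdet] at h
  simp only [inv_one, abs_one, ENNReal.ofReal_one, one_smul] at h
  exact h

/-- The standard Gaussian measure on `ℂⁿ` is unitarily invariant, since both its density, a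
function of `∑ |vᵢ|²`, and Lebesgue measure are. -/
theorem map_pi_complexGaussian_mulVec_unitary {ι : Type*} [Fintype ι] [DecidableEq ι]
    (U : Matrix.unitaryGroup ι ℂ) :
    (Measure.pi fun _ : ι => complexGaussian).map (fun v => (U : Matrix ι ι ℂ) *ᵥ v) =
      Measure.pi fun _ : ι => complexGaussian := by
  have hf : Measurable fun v : ι → ℂ => (U : Matrix ι ι ℂ) *ᵥ v :=
    (by fun_prop : Continuous fun v : ι → ℂ => (U : Matrix ι ι ℂ) *ᵥ v).measurable
  ext s hs
  rw [Measure.map_apply hf hs, pi_complexGaussian_eq_withDensity, withDensity_apply _ (hf hs),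
    withDensity_apply _ hs]
  conv_rhs => rw [← map_volume_mulVec_unitary U]
  rw [setLIntegral_map hs (by fun_prop) hf]
  refine lintegral_congr fun v => ?_
  have hd : ∀ w : ι → ℂ, ∏ i, Real.pi⁻¹ * Real.exp (-‖w i‖ ^ 2) =
      (∏ _i : ι, Real.pi⁻¹) * Real.exp (-∑ i, ‖w i‖ ^ 2) := fun w => by
    rw [Finset.prod_mul_distrib, ← Real.exp_sum, Finset.sum_neg_distrib]
  rw [hd, hd, sum_normSq_mulVec_unitary]

/-- For a standard Gaussian vector, `|v₀|² / ∑ |vᵢ|²` has the tail of `Beta(1, n)`: conditionally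
on the other coordinates, the event is that the exponential variable `|v₀|²` exceeds
`t ∑_{i ≠ 0} |vᵢ|²` with `t = r / (1 - r)`. -/
theorem pi_complexGaussian_ratio_gt (n : ℕ) {r : ℝ} (h0 : 0 ≤ r) (h1 : r < 1) :
    (Measure.pi fun _ : Fin (n + 1) => complexGaussian)
      {v | r * ∑ i, ‖v i‖ ^ 2 < ‖v 0‖ ^ 2} = ENNReal.ofReal ((1 - r) ^ n) := by
  have hr : 0 < 1 - r := by linarith
  set t := r / (1 - r) with ht
  have ht0 : 0 ≤ t := by positivity
  let T : Set (ℂ × (Fin n → ℂ)) := {p | t * ∑ i, ‖p.2 i‖ ^ 2 < ‖p.1‖ ^ 2}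
  have hT : MeasurableSet T := measurableSet_lt (by fun_prop) (by fun_prop)
  have hpre : {v : Fin (n + 1) → ℂ | r * ∑ i, ‖v i‖ ^ 2 < ‖v 0‖ ^ 2} =
      MeasurableEquiv.piFinSuccAbove (fun _ => ℂ) 0 ⁻¹' T := by
    ext v
    have : v ∈ MeasurableEquiv.piFinSuccAbove (fun _ => ℂ) 0 ⁻¹' T ↔
        t * ∑ i : Fin n, ‖v i.succ‖ ^ 2 < ‖v 0‖ ^ 2 := Iff.rfl
    rw [this, Set.mem_ofPred_eq, Fin.sum_univ_succ, ht, div_mul_eq_mul_div, div_lt_iff₀ hr]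
    constructor <;> intro h <;> nlinarith
  rw [hpre, (measurePreserving_piFinSuccAbove (fun _ => complexGaussian) 0).measure_preimage
    hT.nullMeasurableSet, Measure.prod_apply_symm hT]
  -- the conditional probability of the event, given the coordinates `w` other than the first
  have hs : ∀ w : Fin n → ℂ, complexGaussian ((fun z => (z, w)) ⁻¹' T) =
      ENNReal.ofReal (∏ i, Real.exp (-t * ‖w i‖ ^ 2)) := by
    intro w
    have := complexGaussian_normSq_gt (s := t * ∑ i, ‖w i‖ ^ 2) (by positivity)
    rw [← Real.exp_sum, ← Finset.mul_sum, neg_mul, ← this]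
    rfl
  simp_rw [hs]
  have hint : Integrable (fun z : ℂ => Real.exp (-t * ‖z‖ ^ 2)) complexGaussian := by
    refine Integrable.of_integral_ne_zero ?_
    rw [integral_exp_neg_mul_normSq_complexGaussian ht0]
    positivity
  rw [← ofReal_integral_eq_lintegral_ofReal (Integrable.fintype_prod_dep fun _ => hint)
      (Filter.Eventually.of_forall fun z => by positivity),
    integral_fintype_prod_eq_prod (fun _ z => Real.exp (-t * ‖z‖ ^ 2)),
    integral_exp_neg_mul_normSq_complexGaussian ht0]
  congr 1
  have : (1 + t)⁻¹ = 1 - r := by rw [ht]; field_simp; ring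
  simp [this]

/-! ### The Beta distribution with first parameter one -/

theorem betaMeasure_one_Ioi {m r : ℝ} (hm : 0 < m) (h0 : 0 ≤ r) (h1 : r ≤ 1) :
    ProbabilityTheory.betaMeasure 1 m (Set.Ioi r) = ENNReal.ofReal ((1 - r) ^ m) := by
  have hb : ProbabilityTheory.beta 1 m = m⁻¹ := by
    rw [ProbabilityTheory.beta, Real.Gamma_one, add_comm, Real.Gamma_add_one hm.ne', one_mul]
    have := (Real.Gamma_pos_of_pos hm).ne'
    field_simp
  have hd : ∀ x, (Set.Ioi r).indicator (ProbabilityTheory.betaPDF 1 m) x =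
      (Set.Ioo r 1).indicator (fun x => ENNReal.ofReal (m * (1 - x) ^ (m - 1))) x := by
    intro x
    simp only [Set.indicator, Set.mem_Ioi, Set.mem_Ioo]
    split_ifs with h h' h'
    · rw [ProbabilityTheory.betaPDF_of_pos_lt_one (h0.trans_lt h) h'.2, hb]
      simp
    · exact ProbabilityTheory.betaPDF_eq_zero_of_one_le (by by_contra! hx; exact h' ⟨h, hx⟩)
    · exact absurd h'.1 h
    · rfl
  rw [ProbabilityTheory.betaMeasure, withDensity_apply _ measurableSet_Ioi,
    ← lintegral_indicator measurableSet_Ioi]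
  simp_rw [hd]
  have hii : IntervalIntegrable (fun x : ℝ => m * (1 - x) ^ (m - 1)) volume r 1 := by
    have := (intervalIntegral.intervalIntegrable_rpow' (a := 1 - r) (b := 0)
      (by linarith : -1 < m - 1)).comp_sub_left 1
    simpa using this.const_mul m
  rw [lintegral_indicator measurableSet_Ioo, Measure.restrict_congr_set Ioo_ae_eq_Ioc,
    ← ofReal_integral_eq_lintegral_ofReal
      ((intervalIntegrable_iff_integrableOn_Ioc_of_le h1).1 hii)]
  · rw [← intervalIntegral.integral_of_le h1, intervalIntegral.integral_const_mul,
      intervalIntegral.integral_comp_sub_left (fun x => x ^ (m - 1)) 1, sub_self,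
      integral_rpow (Or.inl (by linarith))]
    congr 1
    rw [sub_add_cancel, Real.zero_rpow hm.ne']
    field_simp
    ring
  · refine (ae_restrict_iff' measurableSet_Ioc).2 (Filter.Eventually.of_forall fun x hx => ?_)
    have : 0 ≤ 1 - x := by linarith [hx.2]
    exact mul_nonneg hm.le (Real.rpow_nonneg this _)

/-- A probability measure on `ℝ` with the tail of `Beta(1, m)` on `[0, 1]` is that distribution. -/
theorem eq_betaMeasure_one_of_Ioi {m : ℝ} (hm : 0 < m) (μ : Measure ℝ) [IsProbabilityMeasure μ]
    (h : ∀ r, 0 ≤ r → r ≤ 1 → μ (Set.Ioi r) = ENNReal.ofReal ((1 - r) ^ m)) :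
    μ = ProbabilityTheory.betaMeasure 1 m := by
  have := ProbabilityTheory.isProbabilityMeasureBeta one_pos hm
  have key : ∀ (ν : Measure ℝ) [IsProbabilityMeasure ν],
      (∀ r, 0 ≤ r → r ≤ 1 → ν (Set.Ioi r) = ENNReal.ofReal ((1 - r) ^ m)) → ∀ r,
      ν (Set.Ioi r) = if r < 0 then 1 else if r ≤ 1 then ENNReal.ofReal ((1 - r) ^ m) else 0 := by
    intro ν _ hν r
    split_ifs with hr hr'
    · refine le_antisymm prob_le_one ?_
      calc (1 : ℝ≥0∞) = ν (Set.Ioi 0) := by simp [hν 0 le_rfl zero_le_one]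
        _ ≤ _ := measure_mono (Set.Ioi_subset_Ioi hr.le)
    · exact hν r (not_lt.1 hr) hr'
    · refine le_antisymm ?_ zero_le
      calc ν (Set.Ioi r) ≤ ν (Set.Ioi 1) := measure_mono (Set.Ioi_subset_Ioi (not_le.1 hr').le)
        _ = 0 := by simp [hν 1 zero_le_one le_rfl, Real.zero_rpow hm.ne']
  refine Measure.ext_of_Iic _ _ fun r => ?_
  rw [← Set.compl_Ioi, prob_compl_eq_one_sub measurableSet_Ioi,
    prob_compl_eq_one_sub measurableSet_Ioi, key μ h,
    key (ProbabilityTheory.betaMeasure 1 m) fun r h0 h1 => betaMeasure_one_Ioi hm h0 h1]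


/-! ### Measurability of the expectation values -/

theorem inner_toEuclideanLin_self {N : ℕ} (A : Matrix (Fin N) (Fin N) ℂ)
    (v : EuclideanSpace ℂ (Fin N)) :
    inner ℂ v (Matrix.toEuclideanLin A v) = star v.ofLp ⬝ᵥ (A *ᵥ v.ofLp) := by
  rw [EuclideanSpace.inner_eq_star_dotProduct, dotProduct_comm]
  rfl

theorem expectation_mk {N : ℕ} (A : Matrix (Fin N) (Fin N) ℂ) (v : EuclideanSpace ℂ (Fin N))
    (hv : v ≠ 0) :
    expectation A (Projectivization.mk ℂ v hv) =
      star v.ofLp ⬝ᵥ (A *ᵥ v.ofLp) / inner ℂ v v := by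
  rw [← inner_toEuclideanLin_self]
  rfl

theorem continuous_expectation_right {N : ℕ} (A : Matrix (Fin N) (Fin N) ℂ) :
    Continuous (expectation A) := by
  rw [continuous_coinduced_dom]
  have : Continuous fun v : {v : EuclideanSpace ℂ (Fin N) // v ≠ 0} =>
      inner ℂ v.1 (Matrix.toEuclideanLin A v.1) / inner ℂ v.1 v.1 := by
    refine Continuous.div ?_ (by fun_prop) fun v => inner_self_ne_zero.2 v.2
    have : Continuous (Matrix.toEuclideanLin A) := LinearMap.continuous_of_finiteDimensional _
    fun_prop
  exact this

theorem expectation_eq_sum {N : ℕ} (A : Matrix (Fin N) (Fin N) ℂ) (x : PureState N) :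
    expectation A x = ∑ i, ∑ j, A i j * expectation (Matrix.single i j 1) x := by
  induction x using Projectivization.ind with
  | h v hv =>
    simp only [expectation_mk]
    have h : ∀ i j, star v.ofLp ⬝ᵥ (Matrix.single i j (1 : ℂ) *ᵥ v.ofLp) =
        star (v i) * v j := by
      intro i j
      rw [Matrix.single_mulVec]
      simp [dotProduct, Function.update_apply]
    simp only [h]
    simp only [dotProduct, Matrix.mulVec, Finset.mul_sum, Finset.sum_div, Pi.star_apply]
    exact Finset.sum_congr rfl fun i _ => Finset.sum_congr rfl fun j _ => by ring

/-- Joint measurability, from the expansion of `⟨x|A|x⟩` in the entries of `A`. -/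
theorem measurable_uncurry_expectation (N : ℕ) :
    Measurable fun p : Matrix (Fin N) (Fin N) ℂ × PureState N => expectation p.1 p.2 := by
  simp_rw [fun p : Matrix (Fin N) (Fin N) ℂ × PureState N => expectation_eq_sum p.1 p.2]
  refine Finset.measurable_sum _ fun i _ => Finset.measurable_sum _ fun j _ => ?_
  refine Measurable.mul ?_ ((continuous_expectation_right _).measurable.comp measurable_snd)
  have : Measurable fun A : Matrix (Fin N) (Fin N) ℂ => A i j :=
    (by fun_prop : Continuous fun A : Matrix (Fin N) (Fin N) ℂ => A i j).measurable
  exact this.comp measurable_fst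

theorem measurable_firstColumnState (N : ℕ) [NeZero N] :
    Measurable fun U : Matrix.unitaryGroup (Fin N) ℂ =>
      (Projectivization.mk ℂ (firstColumn (U : Matrix (Fin N) (Fin N) ℂ))
        (firstColumn_ne_zero U) : PureState N) := by
  refine Continuous.measurable ?_
  have h1 : Continuous (Projectivization.mk' ℂ :
      {v : EuclideanSpace ℂ (Fin N) // v ≠ 0} → PureState N) := continuous_coinduced_rng
  have h2 : Continuous fun U : Matrix.unitaryGroup (Fin N) ℂ =>
      (⟨firstColumn (U : Matrix (Fin N) (Fin N) ℂ), firstColumn_ne_zero U⟩ :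
        {v : EuclideanSpace ℂ (Fin N) // v ≠ 0}) := by
    refine Continuous.subtype_mk ?_ _
    unfold firstColumn
    refine (PiLp.continuous_toLp 2 _).comp (continuous_pi fun i => ?_)
    have : Continuous fun A : Matrix (Fin N) (Fin N) ℂ => A i 0 := by fun_prop
    exact this.comp continuous_subtype_val
  exact h1.comp h2

theorem measurable_unitaryGroup_coe (N : ℕ) :
    Measurable fun U : Matrix.unitaryGroup (Fin N) ℂ => (U : Matrix (Fin N) (Fin N) ℂ) :=
  measurable_subtype_coe

theorem measurable_entry (N : ℕ) (i j : Fin N) :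
    Measurable fun U : Matrix.unitaryGroup (Fin N) ℂ => (U : Matrix (Fin N) (Fin N) ℂ) i j := by
  have : Continuous fun A : Matrix (Fin N) (Fin N) ℂ => A i j := by fun_prop
  exact (this.comp continuous_subtype_val).measurable

/-! ### Invariance of the Haar measure and the law of the shadow -/

instance (N : ℕ) : (haarUnitary N).IsHaarMeasure :=
  inferInstanceAs (Measure.haarMeasure _).IsHaarMeasure

instance (N : ℕ) : IsProbabilityMeasure (haarUnitary N) := by
  constructor
  have := Measure.haarMeasure_self
    (K₀ := (⊤ : TopologicalSpace.PositiveCompacts (Matrix.unitaryGroup (Fin N) ℂ)))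
  simpa [haarUnitary] using this

/-- The group `U(N)` is unimodular: a right translate of its normalized left Haar measure is again a
left Haar probability measure, hence the same measure. -/
instance (N : ℕ) : (haarUnitary N).IsMulRightInvariant := by
  refine ⟨fun g => ?_⟩
  have := Measure.isProbabilityMeasure_map (μ := haarUnitary N)
    (measurable_mul_const g).aemeasurable
  exact Measure.isHaarMeasure_eq_of_isProbabilityMeasure _ _

instance (N : ℕ) : IsProbabilityMeasure (haarLaw N) :=
  Measure.isProbabilityMeasure_map (measurable_unitaryGroup_coe N).aemeasurable

instance (N : ℕ) [NeZero N] : IsProbabilityMeasure (fubiniStudy N) :=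
  Measure.isProbabilityMeasure_map (measurable_firstColumnState N).aemeasurable

/-- The shadow of a random matrix is the law of `⟨x|A|x⟩` for independent `A` and `x`. -/
theorem randomNumericalShadow_eq_map_prod {N : ℕ} [NeZero N]
    (μ : Measure (Matrix (Fin N) (Fin N) ℂ)) :
    randomNumericalShadow μ =
      (μ.prod (fubiniStudy N)).map fun p => expectation p.1 p.2 := by
  have hm := measurable_uncurry_expectation N
  have h : (numericalShadow : Matrix (Fin N) (Fin N) ℂ → Measure ℂ) = fun A =>
      ((fubiniStudy N).map (Prod.mk A)).map fun p => expectation p.1 p.2 := by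
    funext A
    rw [Measure.map_map hm measurable_prodMk_left]
    rfl
  have hmeas : Measurable (numericalShadow : Matrix (Fin N) (Fin N) ℂ → Measure ℂ) := by
    rw [h]
    exact (Measure.measurable_map _ hm).comp Measurable.map_prodMk_left
  ext s hs
  rw [randomNumericalShadow, Measure.bind_apply hs hmeas.aemeasurable, Measure.map_apply hm hs,
    Measure.prod_apply (hm hs)]
  refine lintegral_congr fun A => ?_
  rw [numericalShadow, Measure.map_apply (continuous_expectation_right A).measurable hs]
  rfl

theorem hasLaw_expectation {N : ℕ} [NeZero N] :
    ProbabilityTheory.HasLaw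
      (fun p : Matrix (Fin N) (Fin N) ℂ × PureState N => expectation p.1 p.2)
      (randomNumericalShadow (haarLaw N)) ((haarLaw N).prod (fubiniStudy N)) :=
  ⟨(measurable_uncurry_expectation N).aemeasurable, (randomNumericalShadow_eq_map_prod _).symm⟩

theorem firstColumn_eq_mulVec {N : ℕ} [NeZero N] (A : Matrix (Fin N) (Fin N) ℂ) :
    (firstColumn A).ofLp = A *ᵥ Pi.single 0 1 := by
  funext i
  simp [firstColumn]

/-- The expectation value of `V` in the state `W|0⟩` is the corner entry of `W* V W`. -/
theorem expectation_firstColumn {N : ℕ} [NeZero N] (V W : Matrix.unitaryGroup (Fin N) ℂ) :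
    expectation (V : Matrix (Fin N) (Fin N) ℂ) (Projectivization.mk ℂ (firstColumn W.1)
      (firstColumn_ne_zero W)) = ((W⁻¹ * V * W : Matrix.unitaryGroup (Fin N) ℂ) :
        Matrix (Fin N) (Fin N) ℂ) 0 0 := by
  have h : ∀ A : Matrix (Fin N) (Fin N) ℂ,
      star (firstColumn W.1).ofLp ⬝ᵥ (A *ᵥ (firstColumn W.1).ofLp) =
        (star W.1 * A * W.1) 0 0 := by
    intro A
    rw [firstColumn_eq_mulVec, Matrix.star_mulVec, Matrix.mulVec_mulVec,
      ← Matrix.dotProduct_mulVec, Matrix.mulVec_mulVec, ← Matrix.star_eq_conjTranspose,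
      ← mul_assoc]
    simp [Pi.star_single]
  have h1 : inner ℂ (firstColumn W.1) (firstColumn W.1) = (1 : ℂ) := by
    have := h 1
    rw [Matrix.one_mulVec, mul_one, Matrix.mem_unitaryGroup_iff'.mp W.2,
      Matrix.one_apply_eq] at this
    rw [← this, EuclideanSpace.inner_eq_star_dotProduct, dotProduct_comm]
  rw [expectation_mk, h, h1, div_one]
  rfl

/-- The shadow of a Haar random unitary matrix is the law of its corner entry: for every fixed `W`
the matrix `W* V W` has the same law as `V`. -/
theorem randomNumericalShadow_haarLaw (N : ℕ) [NeZero N] :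
    randomNumericalShadow (haarLaw N) =
      (haarUnitary N).map fun V : Matrix.unitaryGroup (Fin N) ℂ =>
        (V : Matrix (Fin N) (Fin N) ℂ) 0 0 := by
  have hm := measurable_uncurry_expectation N
  have he := measurable_entry N 0 0
  rw [randomNumericalShadow_eq_map_prod]
  ext s hs
  rw [Measure.map_apply hm hs, Measure.prod_apply_symm (hm hs), fubiniStudy,
    lintegral_map (measurable_measure_prodMk_right (hm hs)) (measurable_firstColumnState N)]
  have h : ∀ W : Matrix.unitaryGroup (Fin N) ℂ,
      haarLaw N ((fun A => (A, (Projectivization.mk ℂ (firstColumn W.1)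
        (firstColumn_ne_zero W) : PureState N))) ⁻¹' ((fun p => expectation p.1 p.2) ⁻¹' s)) =
      (haarUnitary N).map (fun V : Matrix.unitaryGroup (Fin N) ℂ =>
        (V : Matrix (Fin N) (Fin N) ℂ) 0 0) s := by
    intro W
    have hc : Measurable fun V : Matrix.unitaryGroup (Fin N) ℂ => W⁻¹ * V * W := by fun_prop
    have hinv : (haarUnitary N).map (fun V => W⁻¹ * V * W) = haarUnitary N := by
      have := Measure.map_map (μ := haarUnitary N) (measurable_mul_const W)
        (measurable_const_mul W⁻¹)
      rw [map_mul_left_eq_self, map_mul_right_eq_self] at this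
      exact this.symm
    conv_rhs => rw [← hinv]
    rw [Measure.map_map he hc, Measure.map_apply (he.comp hc) hs, haarLaw,
      Measure.map_apply (measurable_unitaryGroup_coe N) (measurable_prodMk_right (hm hs))]
    congr 1
    ext V
    simp only [Set.mem_preimage, expectation_firstColumn, Function.comp_apply]
  simp only [h, lintegral_const, measure_univ, mul_one]

/-- Multiplication by the scalar matrix `c` preserves the Haar measure. -/
theorem map_mul_corner_haarUnitary (N : ℕ) [NeZero N] (c : Circle) :
    ((haarUnitary N).map fun V : Matrix.unitaryGroup (Fin N) ℂ =>
        (V : Matrix (Fin N) (Fin N) ℂ) 0 0).map (fun z => (c : ℂ) * z) =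
      (haarUnitary N).map fun V : Matrix.unitaryGroup (Fin N) ℂ =>
        (V : Matrix (Fin N) (Fin N) ℂ) 0 0 := by
  have he := measurable_entry N 0 0
  let C : Matrix.unitaryGroup (Fin N) ℂ := ⟨(c : ℂ) • 1, by
    rw [Matrix.mem_unitaryGroup_iff]
    rw [star_smul, star_one, smul_mul_smul_comm, one_mul, Complex.star_def, Complex.mul_conj',
      Circle.norm_coe]
    simp⟩
  conv_rhs => rw [← map_mul_left_eq_self (haarUnitary N) C]
  rw [Measure.map_map (by fun_prop) he, Measure.map_map he (measurable_const_mul C)]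
  congr 1
  funext V
  simp [C]

/-! ### The squared modulus of the corner entry -/

/-- The unitary group acts transitively on the unit sphere. -/
theorem exists_unitary_mulVec_single {N : ℕ} [NeZero N] (w : Fin N → ℂ)
    (hw : ∑ i, ‖w i‖ ^ 2 = 1) :
    ∃ W : Matrix.unitaryGroup (Fin N) ℂ, (W : Matrix (Fin N) (Fin N) ℂ) *ᵥ Pi.single 0 1 = w := by
  have hn : ‖WithLp.toLp 2 w‖ = 1 := by
    rw [EuclideanSpace.norm_eq]
    simp [hw]
  have ho : Orthonormal ℂ (({0} : Set (Fin N)).domRestrict fun _ => WithLp.toLp 2 w) := by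
    refine ⟨fun i => hn, fun i j hij => absurd (Subsingleton.elim i j) hij⟩
  obtain ⟨b, hb⟩ := ho.exists_orthonormalBasis_extension_of_card_eq (by simp)
  refine ⟨⟨(EuclideanSpace.basisFun (Fin N) ℂ).toBasis.toMatrix b,
    (EuclideanSpace.basisFun (Fin N) ℂ).toMatrix_orthonormalBasis_mem_unitary b⟩, ?_⟩
  funext i
  have := hb 0 rfl
  simp [Module.Basis.toMatrix_apply, this]

/-- By right invariance, `(V w)₀ / |w|` has the law of `V₀₀` for each fixed `w ≠ 0`. -/
theorem haarUnitary_ratio_gt_const {N : ℕ} [NeZero N] {w : Fin N → ℂ} (hw : w ≠ 0) (r : ℝ) :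
    haarUnitary N {V | r * ∑ i, ‖w i‖ ^ 2 < ‖((V : Matrix (Fin N) (Fin N) ℂ) *ᵥ w) 0‖ ^ 2} =
      haarUnitary N {V | r < ‖(V : Matrix (Fin N) (Fin N) ℂ) 0 0‖ ^ 2} := by
  set S := ∑ i, ‖w i‖ ^ 2 with hS
  have hpos : 0 < S := by
    obtain ⟨i, hi⟩ := Function.ne_iff.1 hw
    exact Finset.sum_pos' (fun i _ => by positivity)
      ⟨i, Finset.mem_univ i, by have := norm_pos_iff.2 hi; positivity⟩
  have hc : ((√S : ℝ) : ℂ) ≠ 0 := by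
    simpa using (Real.sqrt_pos.2 hpos).ne'
  obtain ⟨W, hW⟩ := exists_unitary_mulVec_single (fun i => ((√S : ℝ) : ℂ)⁻¹ * w i) (by
    simp only [norm_mul, norm_inv, Complex.norm_real, Real.norm_eq_abs, mul_pow, inv_pow, sq_abs,
      Real.sq_sqrt hpos.le, ← Finset.mul_sum, ← hS]
    exact inv_mul_cancel₀ hpos.ne')
  have hw' : w = ((√S : ℝ) : ℂ) • ((W : Matrix (Fin N) (Fin N) ℂ) *ᵥ Pi.single 0 1) := by
    rw [hW]
    funext i
    simp [mul_inv_cancel_left₀ hc]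
  have hset : {V : Matrix.unitaryGroup (Fin N) ℂ |
      r * S < ‖((V : Matrix (Fin N) (Fin N) ℂ) *ᵥ w) 0‖ ^ 2} =
      (fun V => V * W) ⁻¹' {V | r < ‖(V : Matrix (Fin N) (Fin N) ℂ) 0 0‖ ^ 2} := by
    ext V
    have h1 : ((V : Matrix (Fin N) (Fin N) ℂ) *ᵥ w) 0 =
        ((√S : ℝ) : ℂ) * ((V * W : Matrix.unitaryGroup (Fin N) ℂ) :
          Matrix (Fin N) (Fin N) ℂ) 0 0 := by
      conv_lhs => rw [hw']
      rw [Matrix.mulVec_smul, Matrix.mulVec_mulVec]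
      simp
    simp only [Set.mem_ofPred_eq, Set.mem_preimage, h1, norm_mul, Complex.norm_real,
      Real.norm_eq_abs, mul_pow, sq_abs, Real.sq_sqrt hpos.le]
    rw [mul_comm r, mul_lt_mul_iff_right₀ hpos]
  rw [hset, measure_preimage_mul_right]

/-- The tail of `|V₀₀|²`. Averaging `haarUnitary_ratio_gt_const` over a Gaussian vector `w` and
exchanging the order of integration, unitary invariance of the Gaussian measure replaces `V w` by
`w`, so that `|V₀₀|²` has the law of `|w₀|² / |w|²`. -/
theorem haarUnitary_corner_gt (n : ℕ) {r : ℝ} (h0 : 0 ≤ r) (h1 : r < 1) :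
    haarUnitary (n + 1) {V | r < ‖(V : Matrix (Fin (n + 1)) (Fin (n + 1)) ℂ) 0 0‖ ^ 2} =
      ENNReal.ofReal ((1 - r) ^ n) := by
  let γ := Measure.pi fun _ : Fin (n + 1) => complexGaussian
  let T : Set (Matrix.unitaryGroup (Fin (n + 1)) ℂ × (Fin (n + 1) → ℂ)) :=
    {p | r * ∑ i, ‖p.2 i‖ ^ 2 < ‖((p.1 : Matrix (Fin (n + 1)) (Fin (n + 1)) ℂ) *ᵥ p.2) 0‖ ^ 2}
  have hT : MeasurableSet T := by
    refine measurableSet_lt (by fun_prop) ?_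
    refine (Measurable.norm ?_).pow_const 2
    simp only [Matrix.mulVec, dotProduct]
    refine Finset.measurable_sum _ fun j _ => Measurable.mul ?_ (by fun_prop)
    exact (measurable_entry (n + 1) 0 j).comp measurable_fst
  -- integrating over `V` first
  have e1 : ((haarUnitary (n + 1)).prod γ) T =
      haarUnitary (n + 1) {V | r < ‖(V : Matrix (Fin (n + 1)) (Fin (n + 1)) ℂ) 0 0‖ ^ 2} := by
    rw [Measure.prod_apply_symm hT]
    have hae : ∀ᵐ w ∂γ, haarUnitary (n + 1) ((fun V => (V, w)) ⁻¹' T) =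
        haarUnitary (n + 1) {V | r < ‖(V : Matrix (Fin (n + 1)) (Fin (n + 1)) ℂ) 0 0‖ ^ 2} := by
      filter_upwards [Measure.ae_ne γ 0] with w hw
      exact haarUnitary_ratio_gt_const hw r
    rw [lintegral_congr_ae hae, lintegral_const, measure_univ, mul_one]
  -- integrating over `w` first
  have e2 : ((haarUnitary (n + 1)).prod γ) T = ENNReal.ofReal ((1 - r) ^ n) := by
    rw [Measure.prod_apply hT]
    have h : ∀ V : Matrix.unitaryGroup (Fin (n + 1)) ℂ,
        γ (Prod.mk V ⁻¹' T) = ENNReal.ofReal ((1 - r) ^ n) := by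
      intro V
      have hf : Measurable fun v : Fin (n + 1) → ℂ =>
          (V : Matrix (Fin (n + 1)) (Fin (n + 1)) ℂ) *ᵥ v :=
        (by fun_prop : Continuous fun v : Fin (n + 1) → ℂ =>
          (V : Matrix (Fin (n + 1)) (Fin (n + 1)) ℂ) *ᵥ v).measurable
      rw [← pi_complexGaussian_ratio_gt n h0 h1]
      conv_rhs => rw [← map_pi_complexGaussian_mulVec_unitary V]
      rw [Measure.map_apply hf (measurableSet_lt (by fun_prop) (by fun_prop))]
      congr 1
      ext v
      simp only [T, Set.mem_preimage, Set.mem_ofPred_eq, sum_normSq_mulVec_unitary]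
    simp only [h, lintegral_const, measure_univ, mul_one]
  rw [← e1, e2]

theorem map_normSq_corner_haarUnitary {N : ℕ} [NeZero N] (hN : 2 ≤ N) :
    (haarUnitary N).map (fun V : Matrix.unitaryGroup (Fin N) ℂ =>
      ‖(V : Matrix (Fin N) (Fin N) ℂ) 0 0‖ ^ 2) =
      ProbabilityTheory.betaMeasure 1 ((N : ℝ) - 1) := by
  obtain ⟨n, rfl⟩ : ∃ n, N = n + 1 := ⟨N - 1, by omega⟩
  have hn : n ≠ 0 := by omega
  have hm : Measurable fun V : Matrix.unitaryGroup (Fin (n + 1)) ℂ =>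
      ‖(V : Matrix (Fin (n + 1)) (Fin (n + 1)) ℂ) 0 0‖ ^ 2 :=
    (measurable_entry (n + 1) 0 0).norm.pow_const 2
  have := Measure.isProbabilityMeasure_map hm.aemeasurable (μ := haarUnitary (n + 1))
  have hc : ((n + 1 : ℕ) : ℝ) - 1 = n := by simp
  rw [hc]
  refine eq_betaMeasure_one_of_Ioi (by positivity) _ fun r h0 h1 => ?_
  rw [Measure.map_apply hm measurableSet_Ioi, Real.rpow_natCast]
  rcases h1.lt_or_eq with h1 | rfl
  · exact haarUnitary_corner_gt n h0 h1
  · have : (fun V : Matrix.unitaryGroup (Fin (n + 1)) ℂ =>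
        ‖(V : Matrix (Fin (n + 1)) (Fin (n + 1)) ℂ) 0 0‖ ^ 2) ⁻¹' Set.Ioi 1 = ∅ := by
      refine Set.eq_empty_of_forall_notMem fun V hV => ?_
      have hle := entry_norm_bound_of_unitary V.2 0 0
      have : (1 : ℝ) < ‖(V : Matrix (Fin (n + 1)) (Fin (n + 1)) ℂ) 0 0‖ ^ 2 := hV
      exact absurd this (not_lt.2 (pow_le_one₀ (norm_nonneg _) hle))
    rw [this]
    simp [hn]

end RandomShadow

theorem mainTheorem5 (N : ℕ) [NeZero N] :
    -- the shadow of a Haar random unitary matrix is a probability measure in the unit disk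
    IsProbabilityMeasure (RandomShadow.randomNumericalShadow (RandomShadow.haarLaw N)) ∧
    RandomShadow.randomNumericalShadow (RandomShadow.haarLaw N)
      (Metric.closedBall (0 : ℂ) 1)ᶜ = 0 ∧
    -- it is invariant under rotations
    (∀ c : Circle,
      (RandomShadow.randomNumericalShadow (RandomShadow.haarLaw N)).map (fun z : ℂ => (c : ℂ) * z) =
        RandomShadow.randomNumericalShadow (RandomShadow.haarLaw N)) ∧
    -- the squared modulus has the distribution Beta(1, N - 1)
    (2 ≤ N →
      (RandomShadow.randomNumericalShadow (RandomShadow.haarLaw N)).map (fun z : ℂ => ‖z‖ ^ 2) =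
        ProbabilityTheory.betaMeasure 1 ((N : ℝ) - 1)) ∧
    -- the same in terms of `⟨x|U|x⟩` for independent random `U` and `x`
    (∀ {Ω : Type*} [MeasurableSpace Ω] (P : Measure Ω) [IsProbabilityMeasure P]
      (U : Ω → Matrix (Fin N) (Fin N) ℂ) (x : Ω → RandomShadow.PureState N),
      ProbabilityTheory.HasLaw U (RandomShadow.haarLaw N) P →
      ProbabilityTheory.HasLaw x (RandomShadow.fubiniStudy N) P →
      ProbabilityTheory.IndepFun U x P →
      ProbabilityTheory.HasLaw (fun ω => RandomShadow.expectation (U ω) (x ω))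
        (RandomShadow.randomNumericalShadow (RandomShadow.haarLaw N)) P ∧
      (2 ≤ N →
        ProbabilityTheory.HasLaw (fun ω => ‖RandomShadow.expectation (U ω) (x ω)‖ ^ 2)
          (ProbabilityTheory.betaMeasure 1 ((N : ℝ) - 1)) P)) := by
  have he := RandomShadow.measurable_entry N 0 0
  have hs := RandomShadow.randomNumericalShadow_haarLaw N
  have hsq : Measurable fun z : ℂ => ‖z‖ ^ 2 := by fun_prop
  have hbeta : 2 ≤ N → (RandomShadow.randomNumericalShadow (RandomShadow.haarLaw N)).map
      (fun z : ℂ => ‖z‖ ^ 2) = ProbabilityTheory.betaMeasure 1 ((N : ℝ) - 1) := fun hN => by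
    rw [hs, Measure.map_map hsq he]
    exact RandomShadow.map_normSq_corner_haarUnitary hN
  refine ⟨?_, ?_, fun c => ?_, hbeta, ?_⟩
  · rw [hs]
    exact Measure.isProbabilityMeasure_map he.aemeasurable
  · rw [hs, Measure.map_apply he Metric.isClosed_closedBall.measurableSet.compl]
    have : (fun V : Matrix.unitaryGroup (Fin N) ℂ => (V : Matrix (Fin N) (Fin N) ℂ) 0 0) ⁻¹'
        (Metric.closedBall (0 : ℂ) 1)ᶜ = ∅ := by
      refine Set.eq_empty_of_forall_notMem fun V hV => hV ?_
      simpa using entry_norm_bound_of_unitary V.2 0 0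
    rw [this, measure_empty]
  · rw [hs]
    exact RandomShadow.map_mul_corner_haarUnitary N c
  · intro Ω _ P _ U x hU hx hind
    have hprod : ProbabilityTheory.HasLaw (fun ω => (U ω, x ω))
        ((RandomShadow.haarLaw N).prod (RandomShadow.fubiniStudy N)) P :=
      ⟨hU.aemeasurable.prodMk hx.aemeasurable, by
        rw [(ProbabilityTheory.indepFun_iff_map_prod_eq_prod_map_map hU.aemeasurable
          hx.aemeasurable).1 hind, hU.map_eq, hx.map_eq]⟩
    have hexp := RandomShadow.hasLaw_expectation.fun_comp hprod
    exact ⟨hexp, fun hN => ProbabilityTheory.HasLaw.fun_comp ⟨hsq.aemeasurable, hbeta hN⟩ hexp⟩
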